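/- Let $\mathfrak H=\mathbb Q\langle x,y\rangle$ be the non-commutative polynomial algebra in $x,y$, put $z=x+y$ and $z_k=x^{k-1}y$ for $k\ge 1$, and let $\mathfrak H^1=\mathbb Q+\mathfrak Hy\supset\mathfrak H^0=\mathbb Q+x\mathfrak Hy$. Let $\check{\mathfrak H}^1$ be the $\mathbb Q$-span of the words in $\mathfrak H^1$ other than the powers $y^m$ ($m\ge 0$). For $k_1\ge 2$, $k_2,\dots,k_l\ge1$ let $$\zeta(k_1,\dots,k_l)=\sum_{m_1>\cdots>m_l>0}\frac1{m_1^{k_1}\cdots m_l^{k_l}},$$ and let $Z\colon\mathfrak H^0\to\mathbb R$ be the $\mathbb Q$-linear map with $Z(1)=1$ and $Z(z_{k_1}\cdots z_{k_l})=\zeta(k_1,\dots,k_l)$. For $n\ge1$ make $\mathfrak H^{\otimes(n+1)}$ an $\mathfrak H$-bimodule by $$a\diamond(w_1\otimes\cdots\otimes w_{n+1})=w_1\otimes\cdots\otimes w_n\otimes aw_{n+1},\qquad (w_1\otimes\cdots\otimes w_{n+1})\diamond b=w_1b\otimes w_2\otimes\cdots\otimes w_{n+1}.$$ Let $\mathcal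 C_n\colon\mathfrak H\to\mathfrak H^{\otimes(n+1)}$ be the unique $\mathbb Q$-linear map with $\mathcal C_n(x)=x\otimes z^{\otimes(n-1)}\otimes y=-\mathcal C_n(y)$ and $\mathcal C_n(ww')=\mathcal C_n(w)\diamond w'+w\diamond\mathcal C_n(w')$ for all $w,w'\in\mathfrak H$. Let $M_n(w_1\otimes\cdots\otimes w_{n+1})=w_1\cdots w_{n+1}$ be the multiplication map, and let $\rho_n=M_n\mathcal C_n\colon\mathfrak H\to\mathfrak H$. **Theorem.** (1) For every $n\ge1$, $\rho_n(\check{\mathfrak H}^1)\subset\ker Z$; in particular $\rho_n(\check{\mathfrak H}^1)\subset\mathfrak H^0$. (2) For $n=1$ this is the Hoffman–Ohno cyclic sum formula: for all $l\ge 0$ and $k_1,\dots,k_l\ge1$, $$\rho_1(z_{k_1}\cdots z_{k_l})=\sum_{j=1}^l\sum_{i=1}^{k_j-1}z_{k_j-i+1}z_{k_{j+1}}\cdots z_{k_l}z_{k_1}\cdots z_{k_{j-1}}z_i-\sum_{j=1}^lz_{k_j+1}z_{k_{j+1}}\cdots z_{k_l}z_{k_1}\cdots z_{k_{j-1}},$$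 and, if some $k_q>1$, $$\sum_{j=1}^l\sum_{i=1}^{k_j-1}\zeta(k_j-i+1,k_{j+1},\dots,k_l,k_1,\dots,k_{j-1},i)=\sum_{j=1}^l\zeta(k_j+1,k_{j+1},\dots,k_l,k_1,\dots,k_{j-1}).$$ -/

import Mathlib

open scoped TensorProduct

namespace CyclicSum

/-- The two letters. -/
inductive Letter : Type
  | x : Letter
  | y : Letter

/-- The non-commutative polynomial algebra `ℚ⟨x, y⟩`. -/
abbrev H : Type := FreeAlgebra ℚ Letter

/-- The indeterminate `x`. -/
noncomputable def X : H := FreeAlgebra.ι ℚ Letter.x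

/-- The indeterminate `y`. -/
noncomputable def Y : H := FreeAlgebra.ι ℚ Letter.y

/-- The element of `H` given by a word (a finite sequence of letters). -/
noncomputable def word (w : List Letter) : H := (w.map (FreeAlgebra.ι ℚ)).prod

/-- `z_k = x ^ (k - 1) y`, used for `k ≥ 1`. -/
noncomputable def zgen (k : ℕ) : H := X ^ (k - 1) * Y

/-- `z_{k_1} ⋯ z_{k_l}`. -/
noncomputable def zword (k : List ℕ) : H := (k.map zgen).prod

/-- `H¹ = ℚ + H y`. -/
noncomputable def H1 : Subalgebra ℚ H where
  carrier := {a | ∃ (c : ℚ) (w : H), a = algebraMap ℚ H c + w * Y}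
  mul_mem' := by
    rintro _ _ ⟨c, w, rfl⟩ ⟨c', w', rfl⟩
    refine ⟨c * c', algebraMap ℚ H c' * w + algebraMap ℚ H c * w' + w * Y * w', ?_⟩
    have h : w * Y * algebraMap ℚ H c' = algebraMap ℚ H c' * (w * Y) :=
      (Algebra.commutes c' (w * Y)).symm
    rw [map_mul, add_mul, mul_add, mul_add, h]
    noncomm_ring
  add_mem' := by
    rintro _ _ ⟨c, w, rfl⟩ ⟨c', w', rfl⟩
    exact ⟨c + c', w + w', by rw [map_add, add_mul]; abel⟩
  algebraMap_mem' c := ⟨c, 0, by simp⟩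

/-- `H⁰ = ℚ + x H y`. -/
noncomputable def H0 : Subalgebra ℚ H where
  carrier := {a | ∃ (c : ℚ) (w : H), a = algebraMap ℚ H c + X * w * Y}
  mul_mem' := by
    rintro _ _ ⟨c, w, rfl⟩ ⟨c', w', rfl⟩
    refine ⟨c * c', algebraMap ℚ H c' * w + algebraMap ℚ H c * w' + w * Y * X * w', ?_⟩
    have h : X * w * Y * algebraMap ℚ H c' = X * (algebraMap ℚ H c' * w) * Y := by
      rw [Algebra.commutes c' w, mul_assoc (X * w), ← Algebra.commutes c' Y]
      noncomm_ring
    have h' : algebraMap ℚ H c * (X * w' * Y) = X * (algebraMap ℚ H c * w') * Y := by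
      rw [← mul_assoc, ← mul_assoc, Algebra.commutes c X]
      noncomm_ring
    rw [map_mul, add_mul, mul_add, mul_add, h, h']
    noncomm_ring
  add_mem' := by
    rintro _ _ ⟨c, w, rfl⟩ ⟨c', w', rfl⟩
    exact ⟨c + c', w + w', by rw [map_add, mul_add, add_mul]; abel⟩
  algebraMap_mem' c := ⟨c, 0, by simp⟩

/-- The `ℚ`-span of the words lying in `H¹` which are not a power of `y`. -/
noncomputable def H1check : Submodule ℚ H :=
  Submodule.span ℚ {u : H | (∃ w : List Letter, u = word w) ∧ u ∈ H1 ∧ ∀ m : ℕ, u ≠ Y ^ m}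

/-! ### Multiple zeta values -/

/-- `ζ(k_1, …, k_n) = ∑_{m_1 > ⋯ > m_n > 0} 1 / (m_1 ^ k_1 ⋯ m_n ^ k_n)`; it is `1` for the empty
index, and only meaningful if the index is empty or `k_1 > 1` and all `k_i ≥ 1`. -/
noncomputable def mzv (k : List ℕ) : ℝ :=
  ∑' m : {m : Fin k.length → ℕ // StrictAnti m ∧ ∀ i, 0 < m i},
    ∏ i : Fin k.length, 1 / ((m.1 i : ℝ) ^ k.get i)

/-- Reads off the index `(k_1, …, k_n)` of a word: `readIndex q w` is the index of `x ^ q w`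
(a final block of `x`s, which no word of `H¹` has, is discarded). -/
def readIndex : ℕ → List Letter → List ℕ
  | _, [] => []
  | q, Letter.x :: w => readIndex (q + 1) w
  | q, Letter.y :: w => (q + 1) :: readIndex 0 w

/-- The linear map on `H` sending each word to the multiple zeta value of its index. Only its
restriction to `H⁰` is meaningful. -/
noncomputable def ZAux : H →ₗ[ℚ] ℝ :=
  (FreeAlgebra.basisFreeMonoid ℚ Letter).constr ℚ
    fun w : FreeMonoid Letter => mzv (readIndex 0 (FreeMonoid.toList w))

/-- The evaluation map `Z : H⁰ → ℝ`. -/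
noncomputable def Z : H0 →ₗ[ℚ] ℝ := ZAux ∘ₗ H0.val.toLinearMap

theorem basis_eq_word (w : List Letter) :
    FreeAlgebra.basisFreeMonoid ℚ Letter (FreeMonoid.ofList w) = word w := by
  have h : FreeAlgebra.basisFreeMonoid ℚ Letter (FreeMonoid.ofList w) =
      FreeAlgebra.equivMonoidAlgebraFreeMonoid.symm
        (MonoidAlgebra.of ℚ (FreeMonoid Letter) (FreeMonoid.ofList w)) := rfl
  rw [h, AlgEquiv.symm_apply_eq, word, map_list_prod, List.map_map]
  clear h
  induction w with
  | nil => rfl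
  | cons a w ih =>
    rw [FreeMonoid.ofList_cons, map_mul, ih, List.map_cons, List.prod_cons]
    congr 1
    simp [FreeAlgebra.equivMonoidAlgebraFreeMonoid]

theorem ZAux_word (w : List Letter) : ZAux (word w) = mzv (readIndex 0 w) := by
  rw [← basis_eq_word, ZAux, Module.Basis.constr_basis, FreeMonoid.toList_ofList]

theorem mzv_nil : mzv [] = 1 := by
  have : Unique {m : Fin ([] : List ℕ).length → ℕ // StrictAnti m ∧ ∀ i, 0 < m i} :=
    { default := ⟨fun _ => 0, fun i => i.elim0, fun i => i.elim0⟩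
      uniq := fun m => Subtype.ext (funext fun i => i.elim0) }
  rw [mzv, tsum_fintype]
  simp

/-- `Z(1) = 1`. -/
theorem Z_one : Z 1 = 1 := by
  have h : (1 : H) = word [] := rfl
  change ZAux 1 = 1
  rw [h, ZAux_word, readIndex, mzv_nil]

theorem zword_eq_word (k : List ℕ) :
    zword k = word (k.flatMap fun a => List.replicate (a - 1) Letter.x ++ [Letter.y]) := by
  induction k with
  | nil => rfl
  | cons a k ih =>
    have hw : ∀ u v, word (u ++ v) = word u * word v := fun u v => by simp [word]
    rw [List.flatMap_cons, hw, hw, ← ih]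
    simp [zword, zgen, word, X, Y]

theorem readIndex_replicate (q r : ℕ) (w : List Letter) :
    readIndex q (List.replicate r Letter.x ++ w) = readIndex (q + r) w := by
  induction r generalizing q with
  | zero => rfl
  | succ r ih =>
    rw [List.replicate_succ, List.cons_append, readIndex, ih]
    congr 1
    omega

/-- `Z(x ^ (k_1 - 1) y ⋯ x ^ (k_n - 1) y) = ζ(k_1, …, k_n)`. -/
theorem Z_zword (k : List ℕ) (hk : ∀ a ∈ k, 1 ≤ a) (h : zword k ∈ H0) :
    Z ⟨zword k, h⟩ = mzv k := by
  change ZAux (zword k) = mzv k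
  rw [zword_eq_word, ZAux_word]
  congr 1
  clear h
  induction k with
  | nil => rfl
  | cons a k ih =>
    have ha : 1 ≤ a := hk a (by simp)
    rw [List.flatMap_cons, List.append_assoc, readIndex_replicate, List.singleton_append,
      readIndex, ih fun b hb => hk b (by simp [hb])]
    congr 1
    omega

/-! ### The bimodule `H^{⊗(n+1)}` and the map `𝒞_n` -/

/-- `H^{⊗(n+1)}`, with factors numbered `0, …, n`; below it carries the bimodule structure `⋄`. -/
def Tens (n : ℕ) : Type := ⨂[ℚ] _ : Fin (n + 1), H

noncomputable instance (n : ℕ) : AddCommGroup (Tens n) :=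
  inferInstanceAs (AddCommGroup (⨂[ℚ] _ : Fin (n + 1), H))

noncomputable instance (n : ℕ) : Module ℚ (Tens n) :=
  inferInstanceAs (Module ℚ (⨂[ℚ] _ : Fin (n + 1), H))

/-- The pure tensor `w 0 ⊗ ⋯ ⊗ w n`. -/
noncomputable def tpure {n : ℕ} (w : Fin (n + 1) → H) : Tens n := PiTensorProduct.tprod ℚ w

/-- Apply a linear map to the `i`-th tensor factor. -/
noncomputable def onFactor {n : ℕ} (i : Fin (n + 1)) (f : H →ₗ[ℚ] H) : Tens n →ₗ[ℚ] Tens n :=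
  PiTensorProduct.map (Function.update (fun _ => LinearMap.id) i f)

theorem onFactor_tpure {n : ℕ} (i : Fin (n + 1)) (f : H →ₗ[ℚ] H) (w : Fin (n + 1) → H) :
    onFactor i f (tpure w) = tpure (Function.update w i (f (w i))) := by
  refine (PiTensorProduct.map_tprod _ w).trans ?_
  unfold tpure
  congr 1
  funext j
  by_cases h : j = i
  · subst h; simp
  · simp [h]

theorem tens_hom_ext {n : ℕ} {f g : Tens n →ₗ[ℚ] Tens n} (h : ∀ w, f (tpure w) = g (tpure w)) :
    f = g :=
  PiTensorProduct.ext (MultilinearMap.ext h)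

theorem onFactor_id {n : ℕ} (i : Fin (n + 1)) :
    onFactor (n := n) i LinearMap.id = LinearMap.id :=
  tens_hom_ext fun w => by simp [onFactor_tpure]

theorem onFactor_comp {n : ℕ} (i : Fin (n + 1)) (f g : H →ₗ[ℚ] H) :
    onFactor (n := n) i (f ∘ₗ g) = onFactor i f ∘ₗ onFactor i g :=
  tens_hom_ext fun w => by simp [onFactor_tpure]

theorem onFactor_add {n : ℕ} (i : Fin (n + 1)) (f g : H →ₗ[ℚ] H) :
    onFactor (n := n) i (f + g) = onFactor i f + onFactor i g :=
  tens_hom_ext fun w => by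
    rw [LinearMap.add_apply, onFactor_tpure, onFactor_tpure, onFactor_tpure, LinearMap.add_apply]
    exact (PiTensorProduct.tprod ℚ).map_update_add w i (f (w i)) (g (w i))

theorem onFactor_smul {n : ℕ} (i : Fin (n + 1)) (c : ℚ) (f : H →ₗ[ℚ] H) :
    onFactor (n := n) i (c • f) = c • onFactor i f :=
  tens_hom_ext fun w => by
    rw [LinearMap.smul_apply, onFactor_tpure, onFactor_tpure, LinearMap.smul_apply]
    exact (PiTensorProduct.tprod ℚ).map_update_smul w i c (f (w i))

/-- `a ⋄ (w_1 ⊗ ⋯ ⊗ w_{n+1}) = w_1 ⊗ ⋯ ⊗ w_n ⊗ a w_{n+1}`. -/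
noncomputable def leftDiamond {n : ℕ} (a : H) : Tens n →ₗ[ℚ] Tens n :=
  onFactor (Fin.last n) (LinearMap.mulLeft ℚ a)

/-- `(w_1 ⊗ ⋯ ⊗ w_{n+1}) ⋄ b = w_1 b ⊗ w_2 ⊗ ⋯ ⊗ w_{n+1}`. -/
noncomputable def rightDiamond {n : ℕ} (b : H) : Tens n →ₗ[ℚ] Tens n :=
  onFactor 0 (LinearMap.mulRight ℚ b)

/-- The left module structure `⋄`. -/
noncomputable instance (n : ℕ) : Module H (Tens n) where
  smul a t := leftDiamond a t
  one_smul t := by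
    change leftDiamond 1 t = t
    rw [leftDiamond, LinearMap.mulLeft_one, onFactor_id, LinearMap.id_apply]
  mul_smul a b t := by
    change leftDiamond (a * b) t = leftDiamond a (leftDiamond b t)
    rw [leftDiamond, LinearMap.mulLeft_mul, onFactor_comp, LinearMap.comp_apply]; rfl
  smul_zero a := map_zero (leftDiamond a)
  smul_add a := map_add (leftDiamond a)
  add_smul a b t := by
    change leftDiamond (a + b) t = leftDiamond a t + leftDiamond b t
    have h : LinearMap.mulLeft ℚ (a + b) = LinearMap.mulLeft ℚ a + LinearMap.mulLeft ℚ b := by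
      ext; simp [add_mul]
    rw [leftDiamond, h, onFactor_add]; rfl
  zero_smul t := by
    change leftDiamond 0 t = 0
    have h : LinearMap.mulLeft ℚ (0 : H) = (0 : ℚ) • LinearMap.id := by ext; simp
    rw [leftDiamond, h, onFactor_smul, zero_smul, LinearMap.zero_apply]

/-- The right module structure `⋄`. -/
noncomputable instance (n : ℕ) : Module Hᵐᵒᵖ (Tens n) where
  smul b t := rightDiamond b.unop t
  one_smul t := by
    change rightDiamond 1 t = t
    rw [rightDiamond, LinearMap.mulRight_one, onFactor_id, LinearMap.id_apply]
  mul_smul a b t := by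
    change rightDiamond (b.unop * a.unop) t = rightDiamond a.unop (rightDiamond b.unop t)
    rw [rightDiamond, LinearMap.mulRight_mul, onFactor_comp, LinearMap.comp_apply]; rfl
  smul_zero a := map_zero (rightDiamond a.unop)
  smul_add a := map_add (rightDiamond a.unop)
  add_smul a b t := by
    change rightDiamond (a.unop + b.unop) t = rightDiamond a.unop t + rightDiamond b.unop t
    have h : LinearMap.mulRight ℚ (a.unop + b.unop) =
        LinearMap.mulRight ℚ a.unop + LinearMap.mulRight ℚ b.unop := by
      ext; simp [mul_add]
    rw [rightDiamond, h, onFactor_add]; rfl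
  zero_smul t := by
    change rightDiamond 0 t = 0
    have h : LinearMap.mulRight ℚ (0 : H) = (0 : ℚ) • LinearMap.id := by ext; simp
    rw [rightDiamond, h, onFactor_smul, zero_smul, LinearMap.zero_apply]

theorem left_smul_def {n : ℕ} (a : H) (t : Tens n) : a • t = leftDiamond a t := rfl

theorem right_smul_def {n : ℕ} (b : H) (t : Tens n) :
    MulOpposite.op b • t = rightDiamond b t := rfl

/-- `a ⋄ (t ⋄ b) = (a ⋄ t) ⋄ b`. -/
instance (n : ℕ) : SMulCommClass H Hᵐᵒᵖ (Tens n) where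
  smul_comm a b t := by
    have h : leftDiamond a ∘ₗ rightDiamond b.unop =
        rightDiamond b.unop ∘ₗ leftDiamond (n := n) a := by
      refine tens_hom_ext fun w => ?_
      simp only [LinearMap.comp_apply, leftDiamond, rightDiamond, onFactor_tpure]
      congr 1
      by_cases h0 : (0 : Fin (n + 1)) = Fin.last n
      · rw [← h0]; simp [mul_assoc]
      · rw [Function.update_comm h0]
        simp [Function.update_of_ne h0, Function.update_of_ne (Ne.symm h0)]
    exact LinearMap.congr_fun h t

instance (n : ℕ) : IsScalarTower ℚ H (Tens n) where
  smul_assoc c a t := by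
    have h : LinearMap.mulLeft ℚ (c • a) = c • LinearMap.mulLeft ℚ a := by ext; simp
    rw [left_smul_def, leftDiamond, h, onFactor_smul]; rfl

instance (n : ℕ) : IsScalarTower ℚ Hᵐᵒᵖ (Tens n) where
  smul_assoc c b t := by
    have h : LinearMap.mulRight ℚ (c • b.unop) = c • LinearMap.mulRight ℚ b.unop := by
      ext; simp
    change rightDiamond (c • b.unop) t = c • rightDiamond b.unop t
    rw [rightDiamond, h, onFactor_smul]; rfl

/-- The tensor `x ⊗ z^{⊗(n-1)} ⊗ y` with `z = x + y`, for `n ≥ 1`. -/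
noncomputable def baseTensor (n : ℕ) : Tens n :=
  tpure fun i => if i = 0 then X else if i = Fin.last n then Y else X + Y

/-- The algebra morphism `w ↦ (w, 𝒞_n(w))` into the square-zero extension of `H` by the bimodule
`H^{⊗(n+1)}`. -/
noncomputable def CHom (n : ℕ) : H →ₐ[ℚ] TrivSqZeroExt H (Tens n) :=
  FreeAlgebra.lift ℚ fun
    | Letter.x => TrivSqZeroExt.inl X + TrivSqZeroExt.inr (baseTensor n)
    | Letter.y => TrivSqZeroExt.inl Y + TrivSqZeroExt.inr (-baseTensor n)

/-- The map `𝒞_n`: the derivation of `H` into the bimodule `H^{⊗(n+1)}` with the values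
`𝒞_n(x) = x ⊗ z^{⊗(n-1)} ⊗ y = -𝒞_n(y)`. -/
noncomputable def C (n : ℕ) : H →ₗ[ℚ] Tens n :=
  (TrivSqZeroExt.sndHom H (Tens n)).restrictScalars ℚ ∘ₗ (CHom n).toLinearMap

theorem fst_CHom (n : ℕ) (w : H) : (CHom n w).fst = w := by
  have h : (TrivSqZeroExt.fstHom ℚ H (Tens n)).comp (CHom n) = AlgHom.id ℚ H := by
    refine FreeAlgebra.hom_ext (funext fun l => ?_)
    cases l <;> simp [CHom, X, Y]
  exact DFunLike.congr_fun h w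

theorem C_X (n : ℕ) : C n X = baseTensor n := by
  change (CHom n X).snd = _
  simp [CHom, X]

theorem C_Y (n : ℕ) : C n Y = -baseTensor n := by
  change (CHom n Y).snd = _
  simp [CHom, Y]

/-- `𝒞_n(w w') = 𝒞_n(w) ⋄ w' + w ⋄ 𝒞_n(w')`. -/
theorem C_mul (n : ℕ) (w w' : H) :
    C n (w * w') = rightDiamond w' (C n w) + leftDiamond w (C n w') := by
  change (CHom n (w * w')).snd = _
  rw [map_mul, TrivSqZeroExt.snd_mul, fst_CHom, fst_CHom, add_comm]
  rfl

/-- The multiplication map `M_n(w_1 ⊗ ⋯ ⊗ w_{n+1}) = w_1 ⋯ w_{n+1}`. -/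
noncomputable def M (n : ℕ) : Tens n →ₗ[ℚ] H :=
  PiTensorProduct.lift (MultilinearMap.mkPiAlgebraFin ℚ (n + 1) H)

theorem M_tpure {n : ℕ} (w : Fin (n + 1) → H) : M n (tpure w) = (List.ofFn w).prod :=
  (PiTensorProduct.lift.tprod w).trans (MultilinearMap.mkPiAlgebraFin_apply w)

/-- `ρ_n = M_n 𝒞_n`. -/
noncomputable def rho (n : ℕ) : H →ₗ[ℚ] H := M n ∘ₗ C n

end CyclicSum

/-!
Since `𝒞_n` is a derivation, `M_n(p ⋄ 𝒞_n(a) ⋄ q)` depends on `n, p, q` only through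
`q z^{n-1} p`. Hence `ρ_n(a) = ρ_1(a z^{n-1})`, because `𝒞_n(z) = 0`, and `ρ_1(a b) = ρ_1(b a)`.
So only `ρ_1` of a word matters, and the word may be rotated until it ends in `y`, where it is some
`z_{k_1} ⋯ z_{k_l}`. The Leibniz rule evaluates `ρ_1` there, and `Z` of the result vanishes by the
cyclic sum formula.

For that formula, consider the series `S(k_1, …, k_l)` of `1 / ((n_1 - q) n_1 ^ k_1 ⋯ n_l ^ k_l)`
over `n_1 > ⋯ > n_l > q ≥ 0`. Applying `1 / (n (n - q)) + 1 / (q n) = 1 / (q (n - q))` to `n = n_1`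
repeatedly, and telescoping when `n_1` no longer occurs outside `1 / (n_1 (n_1 - q))`, turns
`S(k_1, …, k_l)` into `S(k_2, …, k_l, k_1)` up to multiple zeta values. Summed over all rotations
of the index the `S` cancel, which is legitimate because they are finite as soon as some `k_i > 1`.
-/

namespace CyclicSum

open Filter Topology
open scoped ENNReal

theorem sum_Icc_one {A : Type*} [AddCommMonoid A] (f : ℕ → A) (a : ℕ) :
    ∑ i ∈ Finset.Icc 1 a, f i = ∑ i ∈ Finset.range a, f (i + 1) := by
  rw [← Finset.Ico_add_one_right_eq_Icc, Finset.sum_Ico_eq_sum_range, Nat.add_sub_cancel]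
  simp only [add_comm]

theorem tsum_Ioi (f : ℕ → ℝ≥0∞) (p : ℕ) :
    ∑' n : Set.Ioi p, f n = ∑' j, f (p + j + 1) := by
  have hrange : Set.Ioi p = Set.range fun j => p + j + 1 := by
    ext n
    exact ⟨fun hn => ⟨n - (p + 1), by have : p < n := hn; grind⟩, by rintro ⟨j, rfl⟩; grind⟩
  rw [hrange]
  exact tsum_range f fun i j h => by simpa using h

theorem tsum_eq_zero_add_tsum_Ioi (f : ℕ → ℝ≥0∞) :
    ∑' n, f n = f 0 + ∑' n : Set.Ioi 0, f n := by
  rw [tsum_Ioi, tsum_eq_zero_add' ENNReal.summable]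
  simp only [zero_add]

theorem tsum_sum_range (f : ℕ → ℕ → ℝ≥0∞) :
    ∑' q, ∑ r ∈ Finset.range q, f r q = ∑' r, ∑' q : Set.Ioi r, f r q := by
  calc ∑' q, ∑ r ∈ Finset.range q, f r q = ∑' q, ∑' r, if r < q then f r q else 0 := by
        refine tsum_congr fun q => ?_
        rw [tsum_eq_sum (s := Finset.range q) fun r hr => if_neg (by simpa using hr)]
        exact Finset.sum_congr rfl fun r hr => (if_pos (Finset.mem_range.1 hr)).symm
    _ = ∑' r, ∑' q, if r < q then f r q else 0 := ENNReal.tsum_comm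
    _ = ∑' r, ∑' q : Set.Ioi r, f r q := by
        refine tsum_congr fun r => ?_
        simp only [tsum_subtype (Set.Ioi r) (f r), Set.indicator_apply, Set.mem_Ioi]

theorem tsum_Ioi_eq_of_telescoping {d u : ℕ → ℝ≥0∞} {p : ℕ}
    (h : ∀ n, p ≤ n → d (n + 1) + u (n + 1) = u n) (hu : Tendsto u atTop (𝓝 0)) :
    ∑' n : Set.Ioi p, d n = u p := by
  have hpartial (N : ℕ) : ∑ j ∈ Finset.range N, d (p + j + 1) + u (p + N) = u p := by
    induction N with
    | zero => simp
    | succ N ih => rw [Finset.sum_range_succ, add_assoc, ← add_assoc p, h _ (by omega), ih]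
  have hlim := (ENNReal.tendsto_nat_tsum fun j => d (p + j + 1)).add
    (hu.comp (tendsto_add_atTop_nat p))
  simp only [Function.comp_def, add_comm _ p, hpartial, add_zero] at hlim
  rw [tsum_Ioi]
  exact tendsto_nhds_unique hlim tendsto_const_nhds

theorem tsum_Ioi_le_of_telescoping {d u : ℕ → ℝ≥0∞} {p : ℕ}
    (h : ∀ n, p ≤ n → d (n + 1) + u (n + 1) ≤ u n) : ∑' n : Set.Ioi p, d n ≤ u p := by
  have hpartial (N : ℕ) : ∑ j ∈ Finset.range N, d (p + j + 1) + u (p + N) ≤ u p := by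
    induction N with
    | zero => simp
    | succ N ih =>
      rw [Finset.sum_range_succ, add_assoc]
      exact (add_le_add_right (h _ (by omega)) _).trans ih
  rw [tsum_Ioi]
  exact ENNReal.tsum_le_of_sum_range_le fun N => le_self_add.trans (hpartial N)

/-! ### Nested sums -/

/-- The operator `f ↦ (p ↦ ∑_{n > p} n ^ (-a) f(n))`. Composing such operators produces nested
sums; values in `[0, ∞]` make all rearrangements unconditional. -/
noncomputable def tailSum (a : ℕ) : Module.End ℝ≥0∞ (ℕ → ℝ≥0∞) where
  toFun f p := ∑' n : Set.Ioi p, (n : ℝ≥0∞)⁻¹ ^ a * f n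
  map_add' f g := by
    ext p
    simp only [Pi.add_apply, mul_add, ENNReal.tsum_add]
  map_smul' c f := by
    ext p
    simp only [Pi.smul_apply, smul_eq_mul, mul_left_comm _ c, ENNReal.tsum_mul_left,
      RingHom.id_apply]

theorem tailSum_apply (a : ℕ) (f : ℕ → ℝ≥0∞) (p : ℕ) :
    tailSum a f p = ∑' n : Set.Ioi p, (n : ℝ≥0∞)⁻¹ ^ a * f n := rfl

theorem tailSum_mono {a p : ℕ} {f g : ℕ → ℝ≥0∞} (h : ∀ n, p < n → f n ≤ g n) :
    tailSum a f p ≤ tailSum a g p :=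
  ENNReal.tsum_le_tsum fun n => mul_le_mul_right (h n n.2) _

/-- The operator `f ↦ (p ↦ ∑_{n_1 > ⋯ > n_l > p} n_1 ^ (-k_1) ⋯ n_l ^ (-k_l) f(n_1))`, which is the
identity for the empty index. -/
noncomputable def nestedSum : List ℕ → Module.End ℝ≥0∞ (ℕ → ℝ≥0∞)
  | [] => 1
  | a :: k => nestedSum k * tailSum a

theorem nestedSum_cons (a : ℕ) (k : List ℕ) : nestedSum (a :: k) = nestedSum k * tailSum a := rfl

theorem nestedSum_concat (k : List ℕ) (b : ℕ) :
    nestedSum (k ++ [b]) = tailSum b * nestedSum k := by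
  induction k with
  | nil => rw [List.nil_append, nestedSum_cons, nestedSum, one_mul, mul_one]
  | cons a k ih => rw [List.cons_append, nestedSum_cons, ih, mul_assoc, nestedSum_cons]

theorem nestedSum_mono (k : List ℕ) {f g : ℕ → ℝ≥0∞} {p : ℕ} (h : ∀ n, p ≤ n → f n ≤ g n) :
    nestedSum k f p ≤ nestedSum k g p := by
  induction k generalizing f g with
  | nil => exact h p le_rfl
  | cons a _ ih => exact ih fun n hn => tailSum_mono fun m hm => h m (hn.trans hm.le)

theorem nestedSum_congr (k : List ℕ) {f g : ℕ → ℝ≥0∞} {p : ℕ} (h : ∀ n, p ≤ n → f n = g n) :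
    nestedSum k f p = nestedSum k g p :=
  le_antisymm (nestedSum_mono k fun n hn => (h n hn).le)
    (nestedSum_mono k fun n hn => (h n hn).ge)

/-- The multiple zeta value in `[0, ∞]`. -/
noncomputable def emzv (k : List ℕ) : ℝ≥0∞ := nestedSum k 1 0

/-! ### Chains -/

/-- The strictly decreasing sequences of length `l` with all terms above `p`: the index set of
`mzv` for `p = 0`. -/
abbrev Chains (l p : ℕ) : Type := {m : Fin l → ℕ // StrictAnti m ∧ ∀ i, p < m i}

/-- A chain of length `l + 1` above `p` is its smallest term `n`, which is its last one, together
with a chain of length `l` above `n`. -/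
def Chains.snocEquiv (l p : ℕ) : (Σ n : Set.Ioi p, Chains l n) ≃ Chains (l + 1) p where
  toFun c := ⟨Fin.snoc c.2.1 c.1.1, by
    intro i j hij
    induction i using Fin.lastCases with
    | last => exact absurd hij (Fin.le_last j).not_gt
    | cast i =>
      induction j using Fin.lastCases with
      | last => simpa using c.2.2.2 i
      | cast j => simpa using c.2.2.1 (by simpa using hij), by
    intro i
    induction i using Fin.lastCases with
    | last => simpa using Set.mem_Ioi.1 c.1.2
    | cast i => simpa using (Set.mem_Ioi.1 c.1.2).trans (c.2.2.2 i)⟩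
  invFun m := ⟨⟨m.1 (Fin.last l), Set.mem_Ioi.2 (m.2.2 _)⟩, ⟨Fin.init m.1,
    fun _ _ hij => m.2.1 (Fin.castSucc_lt_castSucc_iff.2 hij),
    fun i => m.2.1 (Fin.castSucc_lt_last i)⟩⟩
  left_inv := by
    rintro ⟨⟨n, hn⟩, ⟨m, hm⟩⟩
    refine Sigma.ext (by simp only [Fin.snoc_last]) ?_
    exact (Subtype.heq_iff_coe_eq fun _ => by simp only [Fin.snoc_last]).2
      (by simp only [Fin.init_snoc])
  right_inv m := by simp

theorem nestedSum_ofFn_one {l : ℕ} (k : Fin l → ℕ) (p : ℕ) :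
    nestedSum (List.ofFn k) 1 p = ∑' m : Chains l p, ∏ i, (m.1 i : ℝ≥0∞)⁻¹ ^ k i := by
  induction l generalizing p with
  | zero =>
    have : Unique (Chains 0 p) :=
      { default := ⟨Fin.elim0, fun i => i.elim0, fun i => i.elim0⟩
        uniq := fun m => Subtype.ext (Subsingleton.elim _ _) }
    simp [nestedSum]
  | succ l ih =>
    rw [List.ofFn_succ', List.concat_eq_append, nestedSum_concat, Module.End.mul_apply,
      tailSum_apply, ← (Chains.snocEquiv l p).tsum_eq, ENNReal.tsum_sigma']
    refine tsum_congr fun n => ?_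
    rw [ih, ← ENNReal.tsum_mul_left]
    refine tsum_congr fun m => ?_
    simp [Chains.snocEquiv, Fin.prod_univ_castSucc, mul_comm]

theorem mzv_eq_toReal_emzv (k : List ℕ) : mzv k = (emzv k).toReal := by
  have hk := nestedSum_ofFn_one k.get 0
  rw [List.ofFn_get] at hk
  rw [emzv, hk, ENNReal.tsum_toReal_eq, mzv]
  · simp [ENNReal.toReal_prod]
  · intro m
    refine ENNReal.prod_ne_top fun i _ => ENNReal.pow_ne_top (ENNReal.inv_ne_top.2 ?_)
    exact_mod_cast (m.2.2 i).ne'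

/-! ### The series of the cyclic sum formula -/

/-- The function `n ↦ 1 / (n - q)`, meant for `n > q`. -/
noncomputable def invSub (q n : ℕ) : ℝ≥0∞ := ((n - q : ℕ) : ℝ≥0∞)⁻¹

theorem invSub_zero (n : ℕ) : invSub 0 n = (n : ℝ≥0∞)⁻¹ := rfl

theorem invSub_succ_succ (q n : ℕ) : invSub (q + 1) (n + 1) = invSub q n := by
  rw [invSub, invSub, Nat.add_sub_add_right]

theorem tendsto_invSub (q : ℕ) : Tendsto (invSub q) atTop (𝓝 0) :=
  ENNReal.tendsto_inv_nat_nhds_zero.comp (tendsto_sub_atTop_nat q)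

theorem inv_mul_invSub_add {q n : ℕ} (hq : 0 < q) (hn : q < n) :
    (n : ℝ≥0∞)⁻¹ * invSub q n + (q : ℝ≥0∞)⁻¹ * (n : ℝ≥0∞)⁻¹ = (q : ℝ≥0∞)⁻¹ * invSub q n := by
  obtain ⟨d, rfl⟩ := Nat.exists_eq_add_of_lt hn
  have hq₀ : (q : ℝ≥0∞) ≠ 0 := by exact_mod_cast hq.ne'
  have hn₀ : ((q + d + 1 : ℕ) : ℝ≥0∞) ≠ 0 := Nat.cast_ne_zero.2 (by omega)
  have hd₀ : ((d + 1 : ℕ) : ℝ≥0∞) ≠ 0 := Nat.cast_ne_zero.2 (by omega)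
  have hd : q + d + 1 - q = d + 1 := by omega
  rw [invSub, hd, ← ENNReal.toReal_eq_toReal_iff' (by finiteness) (by finiteness),
    ENNReal.toReal_add (by finiteness) (by finiteness)]
  simp only [ENNReal.toReal_mul, ENNReal.toReal_inv, ENNReal.toReal_natCast]
  push_cast
  field_simp
  ring

theorem tailSum_one_invSub {p q : ℕ} (hq : 0 < q) (hp : q ≤ p) :
    tailSum 1 (invSub q) p = (q : ℝ≥0∞)⁻¹ * ∑ r ∈ Finset.range q, invSub r p := by
  obtain ⟨s, rfl⟩ := Nat.exists_eq_add_of_le' hq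
  rw [tailSum_apply]
  refine tsum_Ioi_eq_of_telescoping
    (d := fun n => (n : ℝ≥0∞)⁻¹ ^ 1 * invSub (s + 1) n)
    (u := fun n => ((s + 1 : ℕ) : ℝ≥0∞)⁻¹ * ∑ r ∈ Finset.range (s + 1), invSub r n)
    (fun n hn => ?_) ?_
  · have hpf := inv_mul_invSub_add (n := n + 1) hq (by omega)
    rw [Finset.sum_range_succ', Finset.sum_range_succ, mul_add, mul_add, add_left_comm, pow_one,
      invSub_zero, hpf]
    simp only [invSub_succ_succ]
  · simpa using ENNReal.Tendsto.const_mul (a := ((s + 1 : ℕ) : ℝ≥0∞)⁻¹)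
      (tendsto_finsetSum (Finset.range (s + 1)) fun r _ => tendsto_invSub r) (Or.inr (by simp))

theorem tailSum_succ_invSub_add {p q : ℕ} (hq : 0 < q) (hp : q ≤ p) (a : ℕ) :
    tailSum (a + 1) (invSub q) p + (q : ℝ≥0∞)⁻¹ * tailSum (a + 1) 1 p =
      (q : ℝ≥0∞)⁻¹ * tailSum a (invSub q) p := by
  simp only [tailSum_apply, ← ENNReal.tsum_mul_left, ← ENNReal.tsum_add]
  refine tsum_congr fun n => ?_
  have hpf := inv_mul_invSub_add hq (hp.trans_lt n.2)
  calc _ = (n : ℝ≥0∞)⁻¹ ^ a *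
        ((n : ℝ≥0∞)⁻¹ * invSub q n + (q : ℝ≥0∞)⁻¹ * (n : ℝ≥0∞)⁻¹) := by
        rw [Pi.one_apply]; ring
    _ = _ := by rw [hpf, mul_left_comm]

theorem tailSum_invSub_add_sum {p q : ℕ} (hq : 0 < q) (hp : q ≤ p) (a : ℕ) :
    tailSum (a + 1) (invSub q) p +
        ∑ i ∈ Finset.Icc 1 a, (q : ℝ≥0∞)⁻¹ ^ i * tailSum (a + 1 - i + 1) 1 p =
      (q : ℝ≥0∞)⁻¹ ^ (a + 1) * ∑ r ∈ Finset.range q, invSub r p := by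
  induction a with
  | zero => simpa using tailSum_one_invSub hq hp
  | succ a ih =>
    have hsum : ∑ i ∈ Finset.Icc 1 (a + 1), (q : ℝ≥0∞)⁻¹ ^ i * tailSum (a + 2 - i + 1) 1 p =
        (q : ℝ≥0∞)⁻¹ * tailSum (a + 2) 1 p + (q : ℝ≥0∞)⁻¹ *
          ∑ i ∈ Finset.Icc 1 a, (q : ℝ≥0∞)⁻¹ ^ i * tailSum (a + 1 - i + 1) 1 p := by
      rw [sum_Icc_one, sum_Icc_one, Finset.sum_range_succ', add_comm, zero_add, pow_one,
        Finset.mul_sum]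
      simp only [pow_succ' _ (_ + 1), mul_assoc, Nat.add_sub_add_right]
      rfl
    rw [hsum, ← add_assoc, tailSum_succ_invSub_add hq hp (a + 1), ← mul_add, ih, ← mul_assoc,
      ← pow_succ']

/-- The series `∑ 1 / ((n_1 - q) n_1 ^ k_1 ⋯ n_l ^ k_l)` over `n_1 > ⋯ > n_l > q ≥ 0`, for
`k = (k_1, …, k_l)`. -/
noncomputable def cyclicSeries (k : List ℕ) : ℝ≥0∞ := ∑' q, nestedSum k (invSub q) q

theorem emzv_concat (k : List ℕ) (b : ℕ) :
    emzv (k ++ [b]) = ∑' n : Set.Ioi 0, (n : ℝ≥0∞)⁻¹ ^ b * nestedSum k 1 n := by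
  rw [emzv, nestedSum_concat, Module.End.mul_apply, tailSum_apply]

theorem cyclicSeries_concat (k : List ℕ) (b : ℕ) :
    cyclicSeries (k ++ [b]) = ∑' n : Set.Ioi 0,
      (n : ℝ≥0∞)⁻¹ ^ b * ∑ q ∈ Finset.range n, nestedSum k (invSub q) n := by
  calc cyclicSeries (k ++ [b])
    _ = ∑' q, ∑' n : Set.Ioi q, (n : ℝ≥0∞)⁻¹ ^ b * nestedSum k (invSub q) n := by
      simp only [cyclicSeries, nestedSum_concat, Module.End.mul_apply, tailSum_apply]
    _ = ∑' n : ℕ, ∑ q ∈ Finset.range n, (n : ℝ≥0∞)⁻¹ ^ b * nestedSum k (invSub q) n :=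
      (tsum_sum_range fun q n => (n : ℝ≥0∞)⁻¹ ^ b * nestedSum k (invSub q) n).symm
    _ = _ := by
      rw [tsum_eq_zero_add_tsum_Ioi, Finset.range_zero, Finset.sum_empty, zero_add]
      simp only [Finset.mul_sum]

theorem tailSum_invSub_zero (a : ℕ) : tailSum a (invSub 0) = tailSum (a + 1) 1 := by
  ext p
  simp only [tailSum_apply, invSub_zero, Pi.one_apply, mul_one, pow_succ]

theorem nestedSum_cons_invSub_add_sum {q : ℕ} (hq : 0 < q) (a : ℕ) (k : List ℕ) :
    nestedSum ((a + 1) :: k) (invSub q) q +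
        ∑ i ∈ Finset.Icc 1 a, (q : ℝ≥0∞)⁻¹ ^ i * nestedSum ((a + 1 - i + 1) :: k) 1 q =
      (q : ℝ≥0∞)⁻¹ ^ (a + 1) * ∑ r ∈ Finset.range q, nestedSum k (invSub r) q := by
  have h := nestedSum_congr k (p := q)
    (f := tailSum (a + 1) (invSub q) +
      ∑ i ∈ Finset.Icc 1 a, (q : ℝ≥0∞)⁻¹ ^ i • tailSum (a + 1 - i + 1) 1)
    (g := (q : ℝ≥0∞)⁻¹ ^ (a + 1) • ∑ r ∈ Finset.range q, invSub r)
    fun n hn => by simpa using tailSum_invSub_add_sum hq hn a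
  simpa [nestedSum_cons] using h

theorem cyclicSeries_cons_add_sum {a : ℕ} (ha : 1 ≤ a) (k : List ℕ) :
    cyclicSeries (a :: k) + ∑ i ∈ Finset.Icc 1 (a - 1), emzv ((a - i + 1) :: k ++ [i]) =
      emzv ((a + 1) :: k) + cyclicSeries (k ++ [a]) := by
  obtain ⟨a, rfl⟩ := Nat.exists_eq_add_of_le' ha
  have hzero : nestedSum ((a + 1) :: k) (invSub 0) 0 = emzv ((a + 1 + 1) :: k) := by
    rw [emzv, nestedSum_cons, nestedSum_cons, Module.End.mul_apply, Module.End.mul_apply,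
      tailSum_invSub_zero]
  rw [Nat.add_sub_cancel, cyclicSeries, tsum_eq_zero_add_tsum_Ioi, add_assoc, hzero]
  simp only [emzv_concat, cyclicSeries_concat]
  rw [← Summable.tsum_finsetSum fun _ _ => ENNReal.summable, ← ENNReal.tsum_add]
  congr 1
  exact tsum_congr fun q => nestedSum_cons_invSub_add_sum q.2 a k

/-! ### Convergence -/

/-- The sum `3 + H_n` with `H_n` the harmonic number, an upper bound for `∑_{q < n} 1 / (n - q)`.
The constant `3` makes `tailSum_one_harmonicWeight_le` hold from `p = 0` on. -/
noncomputable def harmonicBound (n : ℕ) : ℝ≥0∞ := 3 + ∑ j ∈ Finset.range n, ((j + 1 : ℕ) : ℝ≥0∞)⁻¹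

/-- The function `n ↦ (3 + H_n) / (n + 1)`. As `tailSum a` with `a ≥ 1` at most doubles it, it
controls nested sums of any depth. -/
noncomputable def harmonicWeight (n : ℕ) : ℝ≥0∞ := ((n + 1 : ℕ) : ℝ≥0∞)⁻¹ * harmonicBound n

theorem harmonicBound_ne_top (n : ℕ) : harmonicBound n ≠ ∞ :=
  ENNReal.add_ne_top.2 ⟨by finiteness, ENNReal.sum_ne_top.2 fun j _ => by simp⟩

theorem harmonicWeight_ne_top (n : ℕ) : harmonicWeight n ≠ ∞ :=
  ENNReal.mul_ne_top (by simp) (harmonicBound_ne_top n)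

theorem sum_invSub_le_harmonicBound {n m : ℕ} (h : n ≤ m) :
    ∑ q ∈ Finset.range n, invSub q m ≤ harmonicBound m := by
  calc ∑ q ∈ Finset.range n, invSub q m ≤ ∑ q ∈ Finset.range m, invSub q m :=
        Finset.sum_le_sum_of_subset (Finset.range_mono h)
    _ = ∑ j ∈ Finset.range m, ((j + 1 : ℕ) : ℝ≥0∞)⁻¹ := by
        rw [← Finset.sum_range_reflect]
        refine Finset.sum_congr rfl fun j hj => ?_
        have hj := Finset.mem_range.1 hj
        rw [invSub, show m - (m - 1 - j) = j + 1 by omega]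
    _ ≤ harmonicBound m := le_add_self

theorem harmonicWeight_succ_add_le (n : ℕ) :
    ((n + 1 : ℕ) : ℝ≥0∞)⁻¹ * harmonicWeight (n + 1) + 2 * harmonicWeight (n + 1) ≤
      2 * harmonicWeight n := by
  have hB := harmonicBound_ne_top n
  have hB₃ : 3 ≤ (harmonicBound n).toReal := by
    simpa using ENNReal.toReal_mono hB (le_self_add : 3 ≤ harmonicBound n)
  have hsucc : harmonicBound (n + 1) = harmonicBound n + ((n + 1 : ℕ) : ℝ≥0∞)⁻¹ := by
    rw [harmonicBound, harmonicBound, Finset.sum_range_succ, add_assoc]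
  have hn (m : ℕ) : ((m + 1 : ℕ) : ℝ≥0∞) ≠ 0 := Nat.cast_ne_zero.2 m.succ_ne_zero
  have h₁ := hn n
  have h₂ := hn (n + 1)
  rw [harmonicWeight, harmonicWeight, hsucc,
    ← ENNReal.toReal_le_toReal (by finiteness) (by finiteness)]
  rw [ENNReal.toReal_add (by finiteness) (by finiteness)]
  simp only [ENNReal.toReal_mul, ENNReal.toReal_inv, ENNReal.toReal_natCast, ENNReal.toReal_ofNat,
    ENNReal.toReal_add hB (ENNReal.inv_ne_top.2 h₁)]
  generalize (harmonicBound n).toReal = B at hB₃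
  push_cast
  field_simp
  nlinarith

theorem tailSum_one_harmonicWeight_le (p : ℕ) :
    tailSum 1 harmonicWeight p ≤ 2 * harmonicWeight p :=
  tsum_Ioi_le_of_telescoping (d := fun n => (n : ℝ≥0∞)⁻¹ ^ 1 * harmonicWeight n)
    (u := fun n => 2 * harmonicWeight n) fun n _ => by
      simpa only [pow_one] using harmonicWeight_succ_add_le n

theorem tailSum_antitone {a b : ℕ} (h : a ≤ b) (f : ℕ → ℝ≥0∞) (p : ℕ) :
    tailSum b f p ≤ tailSum a f p :=
  ENNReal.tsum_le_tsum fun n => by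
    gcongr ?_ * _
    have hn : 1 ≤ (n : ℝ≥0∞) := Nat.one_le_cast.2 (Set.mem_Ioi.1 n.2).pos
    exact pow_le_pow_right_of_le_one' (ENNReal.inv_le_one.2 hn) h

theorem natCast_inv_le_two_mul_inv {n : ℕ} (hn : 0 < n) :
    (n : ℝ≥0∞)⁻¹ ≤ 2 * ((n + 1 : ℕ) : ℝ≥0∞)⁻¹ := by
  calc (n : ℝ≥0∞)⁻¹ = 2 * ((2 * n : ℕ) : ℝ≥0∞)⁻¹ := by
        rw [Nat.cast_mul, Nat.cast_ofNat, ENNReal.mul_inv (by simp) (by simp), ← mul_assoc,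
          ENNReal.mul_inv_cancel (by simp) (by simp), one_mul]
    _ ≤ 2 * ((n + 1 : ℕ) : ℝ≥0∞)⁻¹ := by
        gcongr
        omega

theorem tailSum_two_harmonicBound_le (p : ℕ) :
    tailSum 2 harmonicBound p ≤ 4 * harmonicWeight p := by
  calc tailSum 2 harmonicBound p ≤ tailSum 1 ((2 : ℝ≥0∞) • harmonicWeight) p :=
        ENNReal.tsum_le_tsum fun n => by
          rw [pow_two, pow_one, mul_assoc, Pi.smul_apply, harmonicWeight, smul_eq_mul,
            ← mul_assoc 2]
          gcongr
          exact natCast_inv_le_two_mul_inv (Set.mem_Ioi.1 n.2).pos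
    _ = 2 * tailSum 1 harmonicWeight p := by rw [map_smul, Pi.smul_apply, smul_eq_mul]
    _ ≤ 2 * (2 * harmonicWeight p) := by gcongr; exact tailSum_one_harmonicWeight_le p
    _ = 4 * harmonicWeight p := by ring

theorem nestedSum_harmonicWeight_le {k : List ℕ} (hk : ∀ b ∈ k, 1 ≤ b) (p : ℕ) :
    nestedSum k harmonicWeight p ≤ 2 ^ k.length * harmonicWeight p := by
  induction k with
  | nil => simp [nestedSum]
  | cons b k ih =>
    rw [List.forall_mem_cons] at hk
    calc nestedSum (b :: k) harmonicWeight p ≤ nestedSum k ((2 : ℝ≥0∞) • harmonicWeight) p :=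
          nestedSum_mono k fun n _ =>
            (tailSum_antitone hk.1 _ n).trans (tailSum_one_harmonicWeight_le n)
      _ = 2 * nestedSum k harmonicWeight p := by rw [map_smul, Pi.smul_apply, smul_eq_mul]
      _ ≤ 2 * (2 ^ k.length * harmonicWeight p) := by gcongr; exact ih hk.2
      _ = 2 ^ (b :: k).length * harmonicWeight p := by rw [List.length_cons, pow_succ']; ring

theorem nestedSum_harmonicBound_ne_top {a : ℕ} {k : List ℕ} (ha : 1 < a) (hk : ∀ b ∈ k, 1 ≤ b)
    (p : ℕ) : nestedSum (a :: k) harmonicBound p ≠ ∞ := by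
  have hle : nestedSum (a :: k) harmonicBound p ≤ 4 * (2 ^ k.length * harmonicWeight p) :=
    calc nestedSum (a :: k) harmonicBound p ≤ nestedSum k ((4 : ℝ≥0∞) • harmonicWeight) p :=
          nestedSum_mono k fun n _ =>
            (tailSum_antitone ha _ n).trans (tailSum_two_harmonicBound_le n)
      _ = 4 * nestedSum k harmonicWeight p := by rw [map_smul, Pi.smul_apply, smul_eq_mul]
      _ ≤ 4 * (2 ^ k.length * harmonicWeight p) := by
          gcongr; exact nestedSum_harmonicWeight_le hk p
  have := harmonicWeight_ne_top p
  exact ne_top_of_le_ne_top (by finiteness) hle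

/-- The indices `(k_1, …, k_l)` of positive integers whose multiple zeta value converges: `k_1 ≥ 2`
unless the index is empty. -/
def Admissible (k : List ℕ) : Prop := (∀ a ∈ k, 1 ≤ a) ∧ ∀ a ∈ k.head?, 1 < a

theorem admissible_cons {a : ℕ} {k : List ℕ} :
    Admissible (a :: k) ↔ 1 < a ∧ ∀ b ∈ k, 1 ≤ b := by
  simp only [Admissible, List.forall_mem_cons, List.head?_cons, Option.mem_some_iff, forall_eq']
  exact ⟨fun h => ⟨h.2, h.1.2⟩, fun h => ⟨⟨h.1.le, h.2⟩, h.1⟩⟩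

theorem admissible_succ_cons {a : ℕ} {k : List ℕ} (h : ∀ b ∈ a :: k, 1 ≤ b) :
    Admissible ((a + 1) :: k) := by
  rw [List.forall_mem_cons] at h
  exact admissible_cons.2 ⟨Nat.lt_add_one_of_le h.1, h.2⟩

theorem admissible_sub_cons_concat {a i : ℕ} {k : List ℕ} (h : ∀ b ∈ a :: k, 1 ≤ b)
    (hi : i ∈ Finset.Icc 1 (a - 1)) : Admissible ((a - i + 1) :: k ++ [i]) := by
  rw [Finset.mem_Icc] at hi
  rw [List.cons_append, admissible_cons, List.forall_mem_append, List.forall_mem_singleton]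
  exact ⟨by omega, (List.forall_mem_cons.1 h).2, hi.1⟩

theorem Admissible.emzv_ne_top {k : List ℕ} (hk : Admissible k) : emzv k ≠ ∞ := by
  obtain _ | ⟨a, k⟩ := k
  · simp [emzv, nestedSum]
  · refine ne_top_of_le_ne_top (nestedSum_harmonicBound_ne_top
      (admissible_cons.1 hk).1 (admissible_cons.1 hk).2 0) (nestedSum_mono _ fun n _ => ?_)
    calc (1 : ℝ≥0∞) ≤ 3 := by norm_num
      _ ≤ harmonicBound n := le_self_add

theorem cyclicSeries_le_nestedSum_harmonicBound {k : List ℕ} (hk : k ≠ []) :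
    cyclicSeries k ≤ nestedSum k harmonicBound 0 := by
  obtain ⟨k, b, rfl⟩ := List.eq_nil_or_concat' k |>.resolve_left hk
  rw [cyclicSeries_concat, nestedSum_concat, Module.End.mul_apply, tailSum_apply]
  refine ENNReal.tsum_le_tsum fun n => mul_le_mul_right ?_ _
  rw [← Finset.sum_apply, ← map_sum]
  exact nestedSum_mono k fun m hm => by
    rw [Finset.sum_apply]
    exact sum_invSub_le_harmonicBound hm

theorem cyclicSeries_rotate_one_ne_top {k : List ℕ} (hk : ∀ a ∈ k, 1 ≤ a)
    (h : cyclicSeries k ≠ ∞) : cyclicSeries (k.rotate 1) ≠ ∞ := by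
  obtain _ | ⟨a, k⟩ := k
  · exact h
  · have ha : 1 ≤ a := hk a List.mem_cons_self
    have hsum : ∑ i ∈ Finset.Icc 1 (a - 1), emzv ((a - i + 1) :: k ++ [i]) ≠ ∞ :=
      ENNReal.sum_ne_top.2 fun i hi => (admissible_sub_cons_concat hk hi).emzv_ne_top
    have hrot := cyclicSeries_cons_add_sum ha k
    rw [List.rotate_cons_succ, List.rotate_zero]
    exact (ENNReal.add_ne_top.1 (hrot ▸ ENNReal.add_ne_top.2 ⟨h, hsum⟩)).2

theorem cyclicSeries_ne_top_of_isRotated {k k' : List ℕ} (hk : ∀ a ∈ k, 1 ≤ a)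
    (h : cyclicSeries k ≠ ∞) (hkk' : k ~r k') : cyclicSeries k' ≠ ∞ := by
  obtain ⟨n, rfl⟩ := hkk'
  induction n with
  | zero => rwa [List.rotate_zero]
  | succ n ih =>
    rw [← List.rotate_rotate]
    exact cyclicSeries_rotate_one_ne_top (fun a ha => hk a (List.mem_rotate.1 ha)) ih

theorem cyclicSeries_ne_top {k : List ℕ} (hk : ∀ a ∈ k, 1 ≤ a) (hk' : ∃ a ∈ k, 1 < a) :
    cyclicSeries k ≠ ∞ := by
  obtain ⟨a, ha, ha'⟩ := hk'
  obtain ⟨u, v, rfl⟩ := List.append_of_mem ha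
  have hvu : ∀ b ∈ v ++ u, 1 ≤ b := fun b hb => hk b (by grind)
  refine cyclicSeries_ne_top_of_isRotated (k := a :: v ++ u) (by grind) ?_ List.isRotated_append
  exact ne_top_of_le_ne_top (nestedSum_harmonicBound_ne_top ha' hvu 0)
    (cyclicSeries_le_nestedSum_harmonicBound (by simp))

/-! ### The cyclic sum formula -/

theorem tail_rotate {α : Type*} (k : List α) (j : Fin k.length) :
    (k.rotate j).tail = k.drop (j + 1) ++ k.take j := by
  rw [List.rotate_eq_drop_append_take j.2.le, List.drop_eq_getElem_cons j.2, List.cons_append,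
    List.tail_cons]

theorem get_cons_tail_rotate {α : Type*} (k : List α) (j : Fin k.length) :
    k.get j :: (k.rotate j).tail = k.rotate j := by
  rw [List.rotate_eq_drop_append_take j.2.le, List.drop_eq_getElem_cons j.2, List.cons_append,
    List.tail_cons, List.get_eq_getElem]

theorem tail_rotate_concat_get {α : Type*} (k : List α) (j : Fin k.length) :
    (k.rotate j).tail ++ [k.get j] = k.rotate (j + 1) := by
  rw [← List.rotate_rotate, ← get_cons_tail_rotate k j, List.rotate_cons_succ, List.rotate_zero,
    List.tail_cons]

theorem sum_rotate_succ {α A : Type*} [AddCommMonoid A] (f : List α → A) (k : List α) :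
    ∑ j : Fin k.length, f (k.rotate (j + 1)) = ∑ j : Fin k.length, f (k.rotate j) := by
  rw [Fin.sum_univ_eq_sum_range fun j => f (k.rotate (j + 1)),
    Fin.sum_univ_eq_sum_range fun j => f (k.rotate j)]
  have h := k.rotate_length
  generalize k.length = l at h ⊢
  cases l with
  | zero => rw [Finset.range_zero, Finset.sum_empty, Finset.sum_empty]
  | succ l => rw [Finset.sum_range_succ, h, Finset.sum_range_succ', List.rotate_zero]

theorem forall_mem_get_cons_tail_rotate {α : Type*} {P : α → Prop} {k : List α}
    (hk : ∀ a ∈ k, P a) (j : Fin k.length) : ∀ a ∈ k.get j :: (k.rotate j).tail, P a := by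
  rw [get_cons_tail_rotate]
  exact fun a ha => hk a (List.mem_rotate.1 ha)

theorem sum_emzv_rotate {k : List ℕ} (hk : ∀ a ∈ k, 1 ≤ a) (hk' : ∃ a ∈ k, 1 < a) :
    ∑ j : Fin k.length, ∑ i ∈ Finset.Icc 1 (k.get j - 1),
        emzv ((k.get j - i + 1) :: (k.rotate j).tail ++ [i]) =
      ∑ j : Fin k.length, emzv ((k.get j + 1) :: (k.rotate j).tail) := by
  have hrot (j : Fin k.length) : cyclicSeries (k.rotate j) +
      ∑ i ∈ Finset.Icc 1 (k.get j - 1), emzv ((k.get j - i + 1) :: (k.rotate j).tail ++ [i]) =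
        emzv ((k.get j + 1) :: (k.rotate j).tail) + cyclicSeries (k.rotate (j + 1)) := by
    rw [← tail_rotate_concat_get, ← cyclicSeries_cons_add_sum (hk _ (List.get_mem k j)),
      get_cons_tail_rotate]
  have hfin : ∑ j : Fin k.length, cyclicSeries (k.rotate j) ≠ ∞ :=
    ENNReal.sum_ne_top.2 fun j _ => cyclicSeries_ne_top
      (fun a ha => hk a (List.mem_rotate.1 ha))
      (hk'.imp fun a ha => ⟨List.mem_rotate.2 ha.1, ha.2⟩)
  have hsum := Finset.sum_congr (rfl : Finset.univ = Finset.univ) fun j _ => hrot j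
  rw [Finset.sum_add_distrib, Finset.sum_add_distrib, sum_rotate_succ cyclicSeries,
    add_comm] at hsum
  exact (ENNReal.add_left_inj hfin).1 hsum

theorem sum_mzv_rotate {k : List ℕ} (hk : ∀ a ∈ k, 1 ≤ a) (hk' : ∃ a ∈ k, 1 < a) :
    ∑ j : Fin k.length, ∑ i ∈ Finset.Icc 1 (k.get j - 1),
        mzv ((k.get j - i + 1) :: (k.rotate j).tail ++ [i]) =
      ∑ j : Fin k.length, mzv ((k.get j + 1) :: (k.rotate j).tail) := by
  have hfinL (j : Fin k.length) : ∀ i ∈ Finset.Icc 1 (k.get j - 1),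
      emzv ((k.get j - i + 1) :: (k.rotate j).tail ++ [i]) ≠ ∞ := fun i hi =>
    (admissible_sub_cons_concat (forall_mem_get_cons_tail_rotate hk j) hi).emzv_ne_top
  have hfinR (j : Fin k.length) : emzv ((k.get j + 1) :: (k.rotate j).tail) ≠ ∞ :=
    (admissible_succ_cons (forall_mem_get_cons_tail_rotate hk j)).emzv_ne_top
  have h := congrArg ENNReal.toReal (sum_emzv_rotate hk hk')
  rw [ENNReal.toReal_sum fun j _ => ENNReal.sum_ne_top.2 (hfinL j),
    ENNReal.toReal_sum fun j _ => hfinR j,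
    Finset.sum_congr rfl fun j _ => ENNReal.toReal_sum (hfinL j)] at h
  simpa only [mzv_eq_toReal_emzv] using h

/-! ### The maps `ρ_n` -/

/-- The map `a ↦ M_n(p ⋄ 𝒞_n(a) ⋄ q)`. Unlike `ρ_n`, the family of these maps is closed under the
Leibniz rule of `𝒞_n`. -/
noncomputable def twistedRho (n : ℕ) (p q : H) : H →ₗ[ℚ] H :=
  M n ∘ₗ leftDiamond p ∘ₗ rightDiamond q ∘ₗ C n

theorem twistedRho_apply (n : ℕ) (p q a : H) :
    twistedRho n p q a = M n (p • MulOpposite.op q • C n a) := rfl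

theorem twistedRho_one_one (n : ℕ) : twistedRho n 1 1 = rho n := by
  ext a
  rw [twistedRho_apply, MulOpposite.op_one, one_smul, one_smul, rho, LinearMap.comp_apply]

theorem twistedRho_mul (n : ℕ) (p q a b : H) :
    twistedRho n p q (a * b) = twistedRho n p (b * q) a + twistedRho n (p * a) q b := by
  simp only [twistedRho_apply]
  rw [C_mul, ← left_smul_def, ← right_smul_def, smul_add, smul_add, map_add, smul_smul,
    ← smul_comm a, smul_smul, MulOpposite.op_mul]

theorem twistedRho_one (n : ℕ) (p q : H) : twistedRho n p q 1 = 0 := by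
  have h := twistedRho_mul n p q 1 1
  rwa [one_mul, one_mul, mul_one, left_eq_add] at h

theorem leftDiamond_rightDiamond_baseTensor (m : ℕ) (p q : H) :
    leftDiamond p (rightDiamond q (baseTensor (m + 1))) =
      tpure (Fin.cons (X * q) (Fin.snoc (α := fun _ => H) (fun _ : Fin m => X + Y) (p * Y))) := by
  rw [baseTensor, rightDiamond, leftDiamond, onFactor_tpure, onFactor_tpure]
  congr 1
  funext i
  induction i using Fin.cases with
  | zero => simp [Function.update, Fin.ext_iff]
  | succ i =>
    induction i using Fin.lastCases with
    | last => simp [Function.update, Fin.ext_iff]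
    | cast i => simp [Function.update, Fin.ext_iff, i.2.ne]

theorem twistedRho_X (m : ℕ) (p q : H) :
    twistedRho (m + 1) p q X = X * (q * (X + Y) ^ m * p) * Y := by
  rw [twistedRho_apply, C_X, left_smul_def, right_smul_def, leftDiamond_rightDiamond_baseTensor,
    M_tpure, List.ofFn_cons, List.prod_cons, List.ofFn_succ', List.concat_eq_append,
    List.prod_append]
  simp [mul_assoc]

theorem twistedRho_Y (m : ℕ) (p q : H) :
    twistedRho (m + 1) p q Y = -twistedRho (m + 1) p q X := by
  simp only [twistedRho_apply, C_X, C_Y, smul_neg, map_neg]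

/-- The map `a ↦ M_1(𝒞_1(a) ⋄ q)`, whose Leibniz rule `cyclicDeriv_mul` rotates its parameter
`q`; it replaces `x` by `x q y` and `y` by `-x q y`. -/
noncomputable def cyclicDeriv (q : H) : H →ₗ[ℚ] H := twistedRho 1 1 q

theorem twistedRho_succ (m : ℕ) (p q a : H) :
    twistedRho (m + 1) p q a = cyclicDeriv (q * (X + Y) ^ m * p) a := by
  have hX (m : ℕ) (p q : H) :
      twistedRho (m + 1) p q X = cyclicDeriv (q * (X + Y) ^ m * p) X := by
    rw [cyclicDeriv, twistedRho_X, twistedRho_X 0, pow_zero, mul_one, mul_one]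
  induction a using FreeAlgebra.induction generalizing m p q with
  | grade0 r => simp only [Algebra.algebraMap_eq_smul_one, map_smul, cyclicDeriv, twistedRho_one]
  | grade1 l =>
    cases l with
    | x => exact hX m p q
    | y =>
      change twistedRho (m + 1) p q Y = cyclicDeriv (q * (X + Y) ^ m * p) Y
      rw [twistedRho_Y, hX, cyclicDeriv, twistedRho_Y 0]
  | mul a b ha hb =>
    have hb' := hb 0 a (q * (X + Y) ^ m * p)
    rw [pow_zero, mul_one, zero_add] at hb'
    calc twistedRho (m + 1) p q (a * b)
      _ = cyclicDeriv (b * (q * (X + Y) ^ m * p)) a + cyclicDeriv (q * (X + Y) ^ m * p * a) b := by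
        rw [twistedRho_mul, ha, hb]
        simp only [mul_assoc]
      _ = twistedRho 1 1 (q * (X + Y) ^ m * p) (a * b) := by
        rw [twistedRho_mul, one_mul, hb', cyclicDeriv]
  | add a b ha hb => rw [map_add, map_add, ha, hb]

theorem rho_succ_eq_cyclicDeriv (m : ℕ) : rho (m + 1) = cyclicDeriv ((X + Y) ^ m) := by
  ext a
  rw [← twistedRho_one_one, twistedRho_succ, one_mul, mul_one]

theorem rho_one_eq_cyclicDeriv : rho 1 = cyclicDeriv 1 := rho_succ_eq_cyclicDeriv 0

theorem cyclicDeriv_one (q : H) : cyclicDeriv q 1 = 0 := twistedRho_one 1 1 q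

theorem cyclicDeriv_X (q : H) : cyclicDeriv q X = X * q * Y := by
  rw [cyclicDeriv, twistedRho_X 0, pow_zero, mul_one, mul_one]

theorem cyclicDeriv_Y (q : H) : cyclicDeriv q Y = -(X * q * Y) := by
  rw [cyclicDeriv, twistedRho_Y 0, ← cyclicDeriv_X, cyclicDeriv]

theorem cyclicDeriv_mul (q a b : H) :
    cyclicDeriv q (a * b) = cyclicDeriv (b * q) a + cyclicDeriv (q * a) b := by
  have hb := twistedRho_succ 0 a q b
  rw [pow_zero, mul_one, zero_add] at hb
  rw [← hb, cyclicDeriv, cyclicDeriv, twistedRho_mul, one_mul]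

theorem cyclicDeriv_pow_X_add_Y (q : H) (m : ℕ) : cyclicDeriv q ((X + Y) ^ m) = 0 := by
  induction m generalizing q with
  | zero => rw [pow_zero, cyclicDeriv_one]
  | succ m ih =>
    rw [pow_succ, cyclicDeriv_mul, ih, map_add, cyclicDeriv_X, cyclicDeriv_Y, add_neg_cancel,
      add_zero]

theorem rho_succ (m : ℕ) (a : H) : rho (m + 1) a = rho 1 (a * (X + Y) ^ m) := by
  rw [rho_succ_eq_cyclicDeriv, rho_one_eq_cyclicDeriv, cyclicDeriv_mul, cyclicDeriv_pow_X_add_Y,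
    add_zero, mul_one]

theorem rho_one_mul_comm (a b : H) : rho 1 (a * b) = rho 1 (b * a) := by
  rw [rho_one_eq_cyclicDeriv, cyclicDeriv_mul, cyclicDeriv_mul, one_mul, one_mul, mul_one,
    mul_one, add_comm]

theorem cyclicDeriv_pow_X (q : H) (m : ℕ) :
    cyclicDeriv q (X ^ m) = ∑ i ∈ Finset.range m, X ^ (m - i) * q * X ^ i * Y := by
  induction m generalizing q with
  | zero => rw [pow_zero, Finset.range_zero, Finset.sum_empty, cyclicDeriv_one]
  | succ m ih =>
    rw [pow_succ', cyclicDeriv_mul, cyclicDeriv_X, ih, Finset.sum_range_succ', add_comm,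
      Nat.sub_zero, pow_succ', pow_zero, mul_one, ← mul_assoc X]
    simp only [Nat.add_sub_add_right, pow_succ', mul_assoc]

theorem cyclicDeriv_list_prod_map {ι : Type*} (q : H) (f : ι → H) (l : List ι) :
    cyclicDeriv q (l.map f).prod = ∑ j : Fin l.length,
      cyclicDeriv (((l.drop (j + 1)).map f).prod * q * ((l.take j).map f).prod) (f (l.get j)) := by
  induction l generalizing q with
  | nil => exact cyclicDeriv_one q
  | cons a l ih =>
    rw [List.map_cons, List.prod_cons, cyclicDeriv_mul, ih]
    simp only [List.length_cons]
    rw [Fin.sum_univ_succ]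
    simp [mul_assoc]

theorem zword_nil : zword [] = 1 := rfl

theorem zword_singleton (a : ℕ) : zword [a] = zgen a := List.prod_singleton

theorem zword_cons (a : ℕ) (k : List ℕ) : zword (a :: k) = zgen a * zword k := by
  rw [zword, List.map_cons, List.prod_cons, zword]

theorem zword_append (k k' : List ℕ) : zword (k ++ k') = zword k * zword k' := by
  rw [zword, List.map_append, List.prod_append, zword, zword]

theorem zgen_succ (m : ℕ) : zgen (m + 1) = X ^ m * Y := rfl

theorem zword_succ_cons {a : ℕ} (ha : 1 ≤ a) (k : List ℕ) :
    zword ((a + 1) :: k) = X * zword (a :: k) := by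
  obtain ⟨m, rfl⟩ := Nat.exists_eq_add_of_le' ha
  simp only [zword_cons, zgen_succ, pow_succ', mul_assoc]

theorem cyclicDeriv_zgen {a : ℕ} (ha : 1 ≤ a) (k : List ℕ) :
    cyclicDeriv (zword k) (zgen a) =
      (∑ i ∈ Finset.Icc 1 (a - 1), zword ((a - i + 1) :: k ++ [i])) - X * zword (k ++ [a]) := by
  obtain ⟨m, rfl⟩ := Nat.exists_eq_add_of_le' ha
  rw [zgen_succ, cyclicDeriv_mul, cyclicDeriv_Y, cyclicDeriv_pow_X, sub_eq_add_neg,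
    Nat.add_sub_cancel, sum_Icc_one]
  simp only [zword_append, zword_cons, zword_nil, zgen_succ, Nat.add_sub_add_right, mul_one,
    mul_assoc]

theorem rho_one_zword {k : List ℕ} (hk : ∀ a ∈ k, 1 ≤ a) :
    rho 1 (zword k) =
      (∑ j : Fin k.length, ∑ i ∈ Finset.Icc 1 (k.get j - 1),
        zword ((k.get j - i + 1) :: (k.rotate j).tail ++ [i])) -
      ∑ j : Fin k.length, zword ((k.get j + 1) :: (k.rotate j).tail) := by
  have hget (j : Fin k.length) : 1 ≤ k.get j := hk _ (List.get_mem k j)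
  have hlast (j : Fin k.length) : zword ((k.get j + 1) :: (k.rotate j).tail) =
      X * zword (k.rotate j) := by
    rw [zword_succ_cons (hget j), get_cons_tail_rotate]
  simp only [hlast]
  rw [rho_one_eq_cyclicDeriv, zword, cyclicDeriv_list_prod_map,
    ← sum_rotate_succ fun k => X * zword k, ← Finset.sum_sub_distrib]
  refine Finset.sum_congr rfl fun j _ => ?_
  rw [mul_one, ← List.prod_append, ← List.map_append, ← tail_rotate, ← zword,
    cyclicDeriv_zgen (hget j), tail_rotate_concat_get]

theorem mem_map_ker_Z_iff {a : H} :
    a ∈ Submodule.map H0.val.toLinearMap (LinearMap.ker Z) ↔ a ∈ H0 ∧ ZAux a = 0 := by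
  constructor
  · rintro ⟨b, hb, rfl⟩
    exact ⟨b.2, hb⟩
  · rintro ⟨ha, ha₀⟩
    exact ⟨⟨a, ha⟩, ha₀, rfl⟩

theorem exists_zword_eq_mul_Y {k : List ℕ} (hk : k ≠ []) : ∃ v : H, zword k = v * Y := by
  obtain ⟨k, b, rfl⟩ := List.eq_nil_or_concat' k |>.resolve_left hk
  exact ⟨zword k * X ^ (b - 1), by rw [zword_append, zword_singleton, zgen, mul_assoc]⟩

theorem Admissible.zword_mem_H0 {k : List ℕ} (hk : Admissible k) : zword k ∈ H0 := by
  obtain _ | ⟨a, k⟩ := k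
  · exact one_mem H0
  · obtain ⟨a, rfl⟩ := Nat.exists_eq_add_of_le' (admissible_cons.1 hk).1.le
    have ha : 1 ≤ a := Nat.lt_add_left_iff_pos.1 (admissible_cons.1 hk).1
    obtain ⟨v, hv⟩ := exists_zword_eq_mul_Y (List.cons_ne_nil a k)
    exact ⟨0, v, by rw [zword_succ_cons ha, hv, map_zero, zero_add, mul_assoc]⟩

theorem Admissible.ZAux_zword {k : List ℕ} (hk : Admissible k) : ZAux (zword k) = mzv k :=
  Z_zword k hk.1 hk.zword_mem_H0

theorem rho_one_zword_mem {k : List ℕ} (hk : ∀ a ∈ k, 1 ≤ a) (hk' : ∃ a ∈ k, 1 < a) :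
    rho 1 (zword k) ∈ Submodule.map H0.val.toLinearMap (LinearMap.ker Z) := by
  have hL (j : Fin k.length) (i : ℕ) (hi : i ∈ Finset.Icc 1 (k.get j - 1)) :
      Admissible ((k.get j - i + 1) :: (k.rotate j).tail ++ [i]) :=
    admissible_sub_cons_concat (forall_mem_get_cons_tail_rotate hk j) hi
  have hR (j : Fin k.length) : Admissible ((k.get j + 1) :: (k.rotate j).tail) :=
    admissible_succ_cons (forall_mem_get_cons_tail_rotate hk j)
  rw [rho_one_zword hk, mem_map_ker_Z_iff]
  constructor
  · exact sub_mem (sum_mem fun j _ => sum_mem fun i hi => (hL j i hi).zword_mem_H0)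
      (sum_mem fun j _ => (hR j).zword_mem_H0)
  · simp only [map_sub, map_sum, (hR _).ZAux_zword]
    rw [← sum_mzv_rotate hk hk', sub_eq_zero]
    exact Finset.sum_congr rfl fun j _ => Finset.sum_congr rfl fun i hi => (hL j i hi).ZAux_zword

theorem word_append (u v : List Letter) : word (u ++ v) = word u * word v := by
  rw [word, List.map_append, List.prod_append, word, word]

theorem word_singleton_x : word [Letter.x] = X := List.prod_singleton

theorem word_singleton_y : word [Letter.y] = Y := List.prod_singleton

theorem one_le_of_mem_readIndex {q a : ℕ} {w : List Letter} (h : a ∈ readIndex q w) : 1 ≤ a := by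
  induction w generalizing q with
  | nil => cases h
  | cons c w ih =>
    cases c with
    | x => exact ih h
    | y =>
      rcases List.mem_cons.1 h with rfl | h
      · exact Nat.le_add_left 1 q
      · exact ih h

theorem zword_readIndex_concat_y (q : ℕ) (w : List Letter) :
    zword (readIndex q (w ++ [Letter.y])) = X ^ q * word (w ++ [Letter.y]) := by
  induction w generalizing q with
  | nil => rw [List.nil_append, readIndex, readIndex, zword_singleton, zgen_succ, word_singleton_y]
  | cons c w ih =>
    cases c with
    | x =>
      rw [List.cons_append, readIndex, ih, pow_succ, mul_assoc, ← word_singleton_x, ← word_append,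
        List.singleton_append]
    | y =>
      rw [List.cons_append, readIndex, zword_cons, ih, pow_zero, one_mul, zgen_succ, mul_assoc,
        ← word_singleton_y, ← word_append, List.singleton_append]

theorem exists_one_lt_mem_readIndex {q : ℕ} {w : List Letter} (h : 0 < q ∨ Letter.x ∈ w) :
    ∃ a ∈ readIndex q (w ++ [Letter.y]), 1 < a := by
  induction w generalizing q with
  | nil => exact ⟨q + 1, List.mem_singleton_self _, by simpa using h⟩
  | cons c w ih =>
    cases c with
    | x => exact ih (Or.inl q.succ_pos)
    | y =>
      rcases h with hq | hx
      · exact ⟨q + 1, List.mem_cons_self, Nat.lt_add_of_pos_left hq⟩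
      · obtain ⟨a, ha, ha'⟩ := ih (q := 0) (Or.inr (by simpa using hx))
        exact ⟨a, List.mem_cons_of_mem _ ha, ha'⟩

theorem rho_one_word_mem {w : List Letter} (hx : Letter.x ∈ w) (hy : Letter.y ∈ w) :
    rho 1 (word w) ∈ Submodule.map H0.val.toLinearMap (LinearMap.ker Z) := by
  obtain ⟨u, v, rfl⟩ := List.append_of_mem hy
  have hrotate : rho 1 (word (u ++ Letter.y :: v)) = rho 1 (word (v ++ u ++ [Letter.y])) := by
    rw [List.append_cons, word_append, rho_one_mul_comm, ← word_append, List.append_assoc]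
  have hzword := zword_readIndex_concat_y 0 (v ++ u)
  rw [pow_zero, one_mul] at hzword
  rw [hrotate, ← hzword]
  refine rho_one_zword_mem (fun a => one_le_of_mem_readIndex) (exists_one_lt_mem_readIndex ?_)
  exact Or.inr (by simpa [or_comm] using hx)

/-- The span of the words in which both letters occur. Unlike `Ȟ¹`, which it
contains, it is stable under rotation of the words and under `a ↦ a z`. -/
noncomputable def mixedWords : Submodule ℚ H :=
  Submodule.span ℚ (word '' {w | Letter.x ∈ w ∧ Letter.y ∈ w})

theorem word_mem_mixedWords {w : List Letter} (hx : Letter.x ∈ w) (hy : Letter.y ∈ w) :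
    word w ∈ mixedWords :=
  Submodule.subset_span ⟨w, ⟨hx, hy⟩, rfl⟩

theorem mul_X_add_Y_mem_mixedWords {a : H} (ha : a ∈ mixedWords) : a * (X + Y) ∈ mixedWords := by
  induction ha using Submodule.span_induction with
  | mem a ha =>
    obtain ⟨w, ⟨hx, hy⟩, rfl⟩ := ha
    rw [mul_add, ← word_singleton_x, ← word_singleton_y, ← word_append, ← word_append]
    exact add_mem (word_mem_mixedWords (List.mem_append_left _ hx) (List.mem_append_left _ hy))
      (word_mem_mixedWords (List.mem_append_left _ hx) (List.mem_append_left _ hy))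
  | zero => rw [zero_mul]; exact zero_mem _
  | add a b _ _ ha hb => rw [add_mul]; exact add_mem ha hb
  | smul c a _ ha => rw [smul_mul_assoc]; exact Submodule.smul_mem _ c ha

theorem mul_X_add_Y_pow_mem_mixedWords {a : H} (ha : a ∈ mixedWords) (m : ℕ) :
    a * (X + Y) ^ m ∈ mixedWords := by
  induction m with
  | zero => rwa [pow_zero, mul_one]
  | succ m ih =>
    rw [pow_succ, ← mul_assoc]
    exact mul_X_add_Y_mem_mixedWords ih

theorem map_rho_mixedWords_le {n : ℕ} (hn : 1 ≤ n) :
    Submodule.map (rho n) mixedWords ≤ Submodule.map H0.val.toLinearMap (LinearMap.ker Z) := by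
  have hone : Submodule.map (rho 1) mixedWords ≤
      Submodule.map H0.val.toLinearMap (LinearMap.ker Z) := by
    rw [mixedWords, Submodule.map_span_le]
    rintro _ ⟨w, ⟨hx, hy⟩, rfl⟩
    exact rho_one_word_mem hx hy
  obtain ⟨m, rfl⟩ := Nat.exists_eq_add_of_le' hn
  rintro _ ⟨a, ha, rfl⟩
  rw [rho_succ]
  exact hone (Submodule.mem_map_of_mem (mul_X_add_Y_pow_mem_mixedWords ha m))

theorem word_replicate_x (m : ℕ) : word (List.replicate m Letter.x) = X ^ m := by
  rw [word, List.map_replicate, List.prod_replicate, X]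

theorem word_replicate_y (m : ℕ) : word (List.replicate m Letter.y) = Y ^ m := by
  rw [word, List.map_replicate, List.prod_replicate, Y]

theorem eq_replicate_y_of_x_notMem {w : List Letter} (hx : Letter.x ∉ w) :
    w = List.replicate w.length Letter.y := by
  refine List.eq_replicate_of_mem fun c hc => ?_
  cases c with
  | x => exact absurd hc hx
  | y => rfl

theorem eq_replicate_x_of_y_notMem {w : List Letter} (hy : Letter.y ∉ w) :
    w = List.replicate w.length Letter.x := by
  refine List.eq_replicate_of_mem fun c hc => ?_
  cases c with
  | x => rfl
  | y => exact absurd hc hy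

theorem pow_X_notMem_H1 {m : ℕ} (hm : m ≠ 0) : X ^ m ∉ H1 := by
  rintro ⟨c, v, hv⟩
  let evalX (r : ℚ) : H →ₐ[ℚ] ℚ := FreeAlgebra.lift ℚ (Letter.rec r 0)
  have hpow (r : ℚ) : r ^ m = c := by
    simpa [evalX, X, Y] using congrArg (evalX r) hv
  have h01 := (hpow 1).trans (hpow 0).symm
  rw [one_pow, zero_pow hm] at h01
  exact one_ne_zero h01

theorem H1check_le_mixedWords : H1check ≤ mixedWords := by
  rw [H1check, Submodule.span_le]
  rintro _ ⟨⟨w, rfl⟩, hH1, hpow⟩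
  have hx : Letter.x ∈ w := by
    by_contra hx
    rw [eq_replicate_y_of_x_notMem hx, word_replicate_y] at hpow
    exact hpow _ rfl
  refine word_mem_mixedWords hx ?_
  by_contra hy
  rw [eq_replicate_x_of_y_notMem hy, word_replicate_x] at hH1
  exact pow_X_notMem_H1 (List.length_pos_of_mem hx).ne' hH1

end CyclicSum

open CyclicSum in
theorem mainTheorem1_general :
    (∀ n : ℕ, 1 ≤ n →
      Submodule.map (rho n) mixedWords ≤ Submodule.map H0.val.toLinearMap (LinearMap.ker Z)) ∧
    (∀ k : List ℕ, (∀ a ∈ k, 1 ≤ a) →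
      rho 1 (zword k) =
        (∑ j : Fin k.length, ∑ i ∈ Finset.Icc 1 (k.get j - 1),
          zword ((k.get j - i + 1) :: (k.rotate j).tail ++ [i])) -
        ∑ j : Fin k.length, zword ((k.get j + 1) :: (k.rotate j).tail)) ∧
    (∀ k : List ℕ, (∀ a ∈ k, 1 ≤ a) → (∃ a ∈ k, 1 < a) →
      (∑ j : Fin k.length, ∑ i ∈ Finset.Icc 1 (k.get j - 1),
        mzv ((k.get j - i + 1) :: (k.rotate j).tail ++ [i])) =
      ∑ j : Fin k.length, mzv ((k.get j + 1) :: (k.rotate j).tail)) :=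
  ⟨fun _ => map_rho_mixedWords_le, fun _ => rho_one_zword, fun _ => sum_mzv_rotate⟩

open CyclicSum in
theorem mainTheorem1 :
    (∀ n : ℕ, 1 ≤ n →
      Submodule.map (rho n) H1check ≤ Submodule.map H0.val.toLinearMap (LinearMap.ker Z)) ∧
    (∀ k : List ℕ, (∀ a ∈ k, 1 ≤ a) →
      rho 1 (zword k) =
        (∑ j : Fin k.length, ∑ i ∈ Finset.Icc 1 (k.get j - 1),
          zword ((k.get j - i + 1) :: (k.rotate j).tail ++ [i])) -
        ∑ j : Fin k.length, zword ((k.get j + 1) :: (k.rotate j).tail)) ∧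
    (∀ k : List ℕ, (∀ a ∈ k, 1 ≤ a) → (∃ a ∈ k, 1 < a) →
      (∑ j : Fin k.length, ∑ i ∈ Finset.Icc 1 (k.get j - 1),
        mzv ((k.get j - i + 1) :: (k.rotate j).tail ++ [i])) =
      ∑ j : Fin k.length, mzv ((k.get j + 1) :: (k.rotate j).tail)) :=
  ⟨fun n hn => (Submodule.map_mono H1check_le_mixedWords).trans (mainTheorem1_general.1 n hn),
    mainTheorem1_general.2⟩
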